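/- For real $\nu\ge 1$ let $J_\nu(x)=\sum_{m\ge 0}\frac{(-1)^m}{m!\,\Gamma(m+\nu+1)}\left(\frac x2\right)^{2m+\nu}$ ($x\ge 0$) be the Bessel function of the first kind of order $\nu$, and let $\tilde J_\nu(x)=\sqrt{x}\,J_\nu(x)$. For an interval $I\subseteq[0,\infty)$ (bounded or not), a function $t:[0,1]\to\mathbb{R}$ and $g\in L^2(I)$ (complex-valued), define for $r\in[0,1]$ $$T_\nu^2 g(r)=\int_I e^{i t(r)s^2}\,\tilde J_\nu(rs)\,\chi_{[\nu,\,\nu+\nu^{2/3}]}(rs)\,s^{-1/4}\,g(s)\,ds ,$$ where the superscript $2$ is an index and $\chi_A$ denotes the characteristic function of $A$. Proposition 3.1. There exists a constant $C>0$ such that for all real $\nu\ge 1$, all intervals $I\subseteq[0,\infty)$, all functions $t:[0,1]\to\mathbb{R}$ and all $g\in L^2(I)$, the integral defining $T_\nu^2g(r)$ converges absolutely for every $r\in[0,1]$, and $$\|T_\nu^2 g\|_{L^2([0,1])}\le C\,\|g\|_{L^2(I)} .$$ If $t$ is measurable, then $T_\nu^2g$ is measurable and hence belongs to $L^2([0,1])$.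 (If $t$ is not measurable, the left-hand side is read as the square root of the lower Lebesgue integral of $|T_\nu^2g|^2$ over $[0,1]$.) -/

import Mathlib

open MeasureTheory Set

noncomputable section

/-- The Bessel function of the first kind `J_ν(x)` of real order `ν`, for `x ≥ 0`, by its
power series `∑ₘ (-1)^m / (m! Γ(m + ν + 1)) (x/2)^(2m + ν)`. -/
def besselJ (ν x : ℝ) : ℝ :=
  (x / 2) ^ ν *
    ∑' m : ℕ, (-1) ^ m / ((m.factorial : ℝ) * Real.Gamma ((m : ℝ) + ν + 1)) * (x / 2) ^ (2 * m)

/-- `J̃_ν(x) = √x J_ν(x)` for `x ≥ 0`. -/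
def besselJTilde (ν x : ℝ) : ℝ := Real.sqrt x * besselJ ν x

/-- The kernel `e^{i t(r) s²} J̃_ν(rs) χ_{[ν, ν + ν^{2/3}]}(rs) s^{-1/4}`, for `r, s ≥ 0`. -/
def transitionKernel (ν : ℝ) (t : ℝ → ℝ) (r s : ℝ) : ℂ :=
  Complex.exp (Complex.I * ((t r * s ^ 2 : ℝ) : ℂ)) *
    ((besselJTilde ν (r * s) *
      (Icc ν (ν + ν ^ (2 / 3 : ℝ))).indicator (fun _ => (1 : ℝ)) (r * s) *
      s ^ (-(1 / 4) : ℝ) : ℝ) : ℂ)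

/-- The operator `T_ν² g(r) = ∫_I e^{i t(r) s²} J̃_ν(rs) χ_{[ν, ν + ν^{2/3}]}(rs) s^{-1/4} g(s) ds`.
The superscript 2 is an index, not a power. -/
def transitionOp (ν : ℝ) (I : Set ℝ) (t : ℝ → ℝ) (g : ℝ → ℂ) (r : ℝ) : ℂ :=
  ∫ s in I, transitionKernel ν t r s * g s

end

/-! The phase has modulus one, so only the size of the kernel matters. The key is a bound uniform in
the order, `|J̃_ν(x)| ≤ C ν^(1/4) (x - ν)^(-1/4)` for `ν < x ≤ 2ν` (`exists_abs_besselJTilde_le`); a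
Schur-type argument then concludes.

The function `u = J̃_ν` solves `u'' = -(1 - μ/x²) u` with `μ = ν² - 1/4`. Its amplitude at infinity
is bounded uniformly in `ν`: an energy argument settles orders in `[1, 2]`, and the three-term
recurrence becomes `J̃_{ν+2} ≈ -J̃_ν` as `x → ∞`, so raising the order by one costs nothing in the
limit. A corrected adiabatic invariant carries this bound from infinity down to `x = ν + ν^(1/3)`,
where the WKB regime ends (`exists_adiabaticEnergy_bound`). On the remaining stretch to `ν`, an
increasing energy controls `u'`, hence the variation of `u`.

On the support, `ν ≤ rs` turns the bound into `C r^(1/4) (rs - ν)^(-1/4)`. The profile `(x -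
ν)^(-1/4)` has mass of order `ν^(1/2)` on the transition window. Cauchy–Schwarz in `s` followed by
Tonelli in `r` yields a constant independent of `ν`. -/

/-! ### Power series, recurrence and differential equation -/

/-- The entire function `∑ₘ (-1)^m z^m / (m! Γ(m + ν + 1))`. -/
noncomputable def besselSeries (ν z : ℝ) : ℝ :=
  ∑' m : ℕ, (-1) ^ m / ((m.factorial : ℝ) * Real.Gamma ((m : ℝ) + ν + 1)) * z ^ m

theorem one_le_Gamma_of_two_le {x : ℝ} (hx : 2 ≤ x) : 1 ≤ Real.Gamma x := by
  have h := Real.Gamma_strictMonoOn_Ici.monotoneOn (show (2 : ℝ) ∈ Ici 2 by simp)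
    (show x ∈ Ici 2 from hx) hx
  rwa [Real.Gamma_two] at h

theorem besselSeries_coeff_bound {ν : ℝ} (hν : 1 ≤ ν) (m : ℕ) :
    ‖(-1 : ℝ) ^ m / ((m.factorial : ℝ) * Real.Gamma ((m : ℝ) + ν + 1))‖
      ≤ 1 / (m.factorial : ℝ) := by
  have hm : (0 : ℝ) ≤ m := Nat.cast_nonneg m
  have h1 : 1 ≤ Real.Gamma ((m : ℝ) + ν + 1) := one_le_Gamma_of_two_le (by linarith)
  have h2 : (0 : ℝ) < m.factorial := by positivity
  rw [norm_div, norm_pow, norm_neg, norm_one, one_pow, Real.norm_of_nonneg (by positivity)]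
  exact one_div_le_one_div_of_le h2 (le_mul_of_one_le_right h2.le h1)

theorem besselSeries_term_bound {ν : ℝ} (hν : 1 ≤ ν) (z : ℝ) (m : ℕ) :
    ‖(-1 : ℝ) ^ m / ((m.factorial : ℝ) * Real.Gamma ((m : ℝ) + ν + 1)) * z ^ m‖
      ≤ |z| ^ m / (m.factorial : ℝ) := by
  rw [norm_mul, norm_pow z, Real.norm_eq_abs z, ← one_div_mul_eq_div (m.factorial : ℝ)]
  exact mul_le_mul_of_nonneg_right (besselSeries_coeff_bound hν m) (by positivity)

theorem summable_besselSeries {ν : ℝ} (hν : 1 ≤ ν) (z : ℝ) :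
    Summable fun m : ℕ =>
      (-1 : ℝ) ^ m / ((m.factorial : ℝ) * Real.Gamma ((m : ℝ) + ν + 1)) * z ^ m :=
  Summable.of_norm_bounded (Real.summable_pow_div_factorial |z|) (besselSeries_term_bound hν z)

theorem abs_besselSeries_le {ν : ℝ} (hν : 1 ≤ ν) (z : ℝ) :
    |besselSeries ν z| ≤ Real.exp |z| := by
  have h := NormedSpace.expSeries_div_hasSum_exp (𝔸 := ℝ) |z|
  rw [← Real.exp_eq_exp_ℝ] at h
  exact tsum_of_norm_bounded h (besselSeries_term_bound hν z)

theorem besselSeries_coeff_succ (ν : ℝ) (m : ℕ) :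
    (-1 : ℝ) ^ (m + 1) / (((m + 1).factorial : ℝ) * Real.Gamma (((m + 1 : ℕ) : ℝ) + ν + 1))
      * ((m : ℝ) + 1) =
      -((-1 : ℝ) ^ m / ((m.factorial : ℝ) * Real.Gamma ((m : ℝ) + (ν + 1) + 1))) := by
  have h2 : (m.factorial : ℝ) ≠ 0 := by positivity
  have h3 : (m : ℝ) + 1 ≠ 0 := by positivity
  rw [Nat.factorial_succ]
  push_cast
  rw [show (m : ℝ) + 1 + ν + 1 = (m : ℝ) + (ν + 1) + 1 by ring, pow_succ]
  rw [show (((m : ℝ) + 1) * m.factorial * Real.Gamma ((m : ℝ) + (ν + 1) + 1))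
    = ((m : ℝ) + 1) * (m.factorial * Real.Gamma ((m : ℝ) + (ν + 1) + 1)) by ring,
    div_mul_eq_mul_div, mul_comm _ ((m : ℝ) + 1), mul_div_mul_left _ _ h3]
  ring

theorem hasDerivAt_besselSeries {ν : ℝ} (hν : 1 ≤ ν) (z : ℝ) :
    HasDerivAt (besselSeries ν) (-besselSeries (ν + 1) z) z := by
  set c : ℕ → ℝ := fun m =>
    (-1 : ℝ) ^ m / ((m.factorial : ℝ) * Real.Gamma ((m : ℝ) + ν + 1)) with hc
  set R : ℝ := |z| + 1
  have hR : 0 ≤ R := by positivity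
  -- This majorant of the differentiated series on the ball of radius `R` is, after an index shift,
  -- the exponential series at `R`.
  have hu : Summable fun m : ℕ => (1 / (m.factorial : ℝ)) * (m * R ^ (m - 1)) := by
    rw [← summable_nat_add_iff 1]
    refine (Real.summable_pow_div_factorial R).congr fun m => ?_
    rw [Nat.factorial_succ]
    push_cast
    have h2 : (m.factorial : ℝ) ≠ 0 := by positivity
    have h3 : (m : ℝ) + 1 ≠ 0 := by positivity
    field_simp
  have hz : z ∈ Metric.ball (0 : ℝ) R := by simp [R]
  have key := hasDerivAt_tsum_of_isPreconnected (g := fun m y => c m * y ^ m)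
    (g' := fun m y => c m * (m * y ^ (m - 1))) hu Metric.isOpen_ball
    (convex_ball (0 : ℝ) R).isPreconnected
    (fun m y _ => (hasDerivAt_pow m y).const_mul (c m))
    (fun m y hy => by
      have hy' : |y| ≤ R := by simpa using (mem_ball_zero_iff.1 hy).le
      rw [norm_mul, norm_mul, norm_pow, Real.norm_natCast, Real.norm_eq_abs y]
      exact mul_le_mul (besselSeries_coeff_bound hν m) (by gcongr) (by positivity)
        (by positivity))
    hz (summable_besselSeries hν z) hz
  have hs : Summable fun m : ℕ => c m * (m * z ^ (m - 1)) := by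
    refine Summable.of_norm_bounded hu fun m => ?_
    rw [norm_mul, norm_mul, norm_pow, Real.norm_natCast, Real.norm_eq_abs z]
    have : |z| ≤ R := by simp [R]
    exact mul_le_mul (besselSeries_coeff_bound hν m) (by gcongr) (by positivity)
        (by positivity)
  have hval : ∑' m : ℕ, c m * (m * z ^ (m - 1)) = -besselSeries (ν + 1) z := by
    rw [hs.tsum_eq_zero_add, besselSeries, ← tsum_neg]
    simp only [Nat.cast_zero, zero_mul, mul_zero, zero_add, Nat.add_sub_cancel]
    refine tsum_congr fun m => ?_
    rw [← neg_mul, ← besselSeries_coeff_succ]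
    simp only [hc]
    push_cast
    ring
  rw [← hval]
  exact key

theorem besselSeries_recurrence {ν : ℝ} (hν : 1 ≤ ν) (z : ℝ) :
    besselSeries ν z = (ν + 1) * besselSeries (ν + 1) z - z * besselSeries (ν + 2) z := by
  set c : ℕ → ℝ := fun m =>
    (-1 : ℝ) ^ m / ((m.factorial : ℝ) * Real.Gamma ((m : ℝ) + (ν + 1) + 1)) with hc
  have h0 := summable_besselSeries hν z
  have h1 : Summable fun m => c m * z ^ m :=
    summable_besselSeries (show 1 ≤ ν + 1 by linarith) z
  have h2 := summable_besselSeries (show 1 ≤ ν + 2 by linarith) z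
  have hterm : ∀ m : ℕ, (-1 : ℝ) ^ m / ((m.factorial : ℝ) * Real.Gamma ((m : ℝ) + ν + 1)) * z ^ m
      - (ν + 1) * (c m * z ^ m) = m * c m * z ^ m := by
    intro m
    have hm : (0 : ℝ) ≤ m := Nat.cast_nonneg m
    have hp : (m : ℝ) + ν + 1 ≠ 0 := by linarith
    have hG : Real.Gamma ((m : ℝ) + ν + 1) ≠ 0 := (Real.Gamma_pos_of_pos (by linarith)).ne'
    have hf : (m.factorial : ℝ) ≠ 0 := by positivity
    simp only [hc]
    rw [← add_assoc (m : ℝ) ν 1, Real.Gamma_add_one hp]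
    field_simp
    ring
  have hs : Summable fun m : ℕ => m * c m * z ^ m :=
    (h0.sub (h1.mul_left (ν + 1))).congr hterm
  have hsum : besselSeries ν z - (ν + 1) * besselSeries (ν + 1) z = ∑' m : ℕ, m * c m * z ^ m := by
    rw [besselSeries, besselSeries, ← tsum_mul_left, ← h0.tsum_sub (h1.mul_left (ν + 1))]
    exact tsum_congr hterm
  have hshift : ∑' m : ℕ, m * c m * z ^ m = -(z * besselSeries (ν + 2) z) := by
    rw [hs.tsum_eq_zero_add, besselSeries, ← tsum_mul_left, ← tsum_neg]
    simp only [Nat.cast_zero, zero_mul, zero_add]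
    refine tsum_congr fun m => ?_
    have := besselSeries_coeff_succ (ν + 1) m
    rw [show ν + 1 + 1 = ν + 2 by ring] at this
    simp only [hc]
    push_cast at this ⊢
    rw [pow_succ z]
    linear_combination z ^ m * z * this
  linarith

theorem besselJTilde_eq (ν x : ℝ) :
    besselJTilde ν x = Real.sqrt x * ((x / 2) ^ ν * besselSeries ν ((x / 2) ^ 2)) := by
  simp only [besselJTilde, besselJ, besselSeries, pow_mul]

theorem continuous_besselJTilde {ν : ℝ} (hν : 1 ≤ ν) : Continuous (besselJTilde ν) := by
  have h : Continuous (besselSeries ν) :=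
    continuous_iff_continuousAt.2 fun z => (hasDerivAt_besselSeries hν z).continuousAt
  rw [show besselJTilde ν = _ from funext (besselJTilde_eq ν)]
  have h2 : Continuous fun x : ℝ => (x / 2) ^ ν :=
    (continuous_id.div_const 2).rpow_const fun _ => Or.inr (by linarith)
  exact Real.continuous_sqrt.mul (h2.mul (h.comp ((continuous_id.div_const 2).pow 2)))

theorem hasDerivAt_besselJTilde {ν x : ℝ} (hν : 1 ≤ ν) (hx : 0 < x) :
    HasDerivAt (besselJTilde ν)
      ((ν + 1 / 2) / x * besselJTilde ν x - besselJTilde (ν + 1) x) x := by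
  rw [show besselJTilde ν = _ from funext (besselJTilde_eq ν), besselJTilde_eq]
  have hx2 : 0 < x / 2 := by positivity
  have hd : HasDerivAt (fun x : ℝ => x / 2) (1 / 2) x := (hasDerivAt_id x).div_const 2
  have h1 := hd.rpow_const (p := ν) (Or.inl hx2.ne')
  have h2 := (hasDerivAt_besselSeries hν ((x / 2) ^ 2)).comp x (hd.pow 2)
  have h3 := (Real.hasDerivAt_sqrt hx.ne').mul (h1.mul h2)
  refine h3.congr_deriv ?_
  have hs : Real.sqrt x ≠ 0 := (Real.sqrt_pos.2 hx).ne'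
  simp only [Function.comp, Pi.pow_apply, Pi.mul_apply]
  rw [Real.rpow_sub_one hx2.ne', Real.rpow_add_one hx2.ne']
  have hsq : Real.sqrt x ^ 2 = x := Real.sq_sqrt hx.le
  field_simp
  rw [hsq]
  push_cast
  ring

theorem besselJTilde_recurrence {ν x : ℝ} (hν : 1 ≤ ν) (hx : 0 < x) :
    besselJTilde (ν + 2) x =
      2 * (ν + 1) / x * besselJTilde (ν + 1) x - besselJTilde ν x := by
  have hx2 : 0 < x / 2 := by positivity
  rw [besselJTilde_eq, besselJTilde_eq, besselJTilde_eq,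
    besselSeries_recurrence hν, Real.rpow_add_one hx2.ne',
    Real.rpow_add hx2, Real.rpow_two]
  field_simp
  ring

/-- The derivative of `besselJTilde ν` on `(0, ∞)`. -/
noncomputable def besselJTildeDeriv (ν x : ℝ) : ℝ :=
  (ν + 1 / 2) / x * besselJTilde ν x - besselJTilde (ν + 1) x

/-- The factor `√x` removes the first-order term of Bessel's equation. The recurrence eliminates the
order `ν + 2` produced by the second differentiation. -/
theorem hasDerivAt_besselJTildeDeriv {ν x : ℝ} (hν : 1 ≤ ν) (hx : 0 < x) :
    HasDerivAt (besselJTildeDeriv ν)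
      (-((1 - (ν ^ 2 - 1 / 4) / x ^ 2) * besselJTilde ν x)) x := by
  have h1 := ((hasDerivAt_inv hx.ne').const_mul (ν + 1 / 2)).mul (hasDerivAt_besselJTilde hν hx)
  have h2 := h1.sub (hasDerivAt_besselJTilde (show 1 ≤ ν + 1 by linarith) hx)
  refine (h2.congr_deriv ?_)
  rw [show ν + 1 + 1 = ν + 2 by ring, besselJTilde_recurrence hν hx]
  field_simp
  ring

/-! ### Energies of the differential equation -/

theorem monotoneOn_Ici_of_hasDerivAt {f f' : ℝ → ℝ} {a : ℝ}
    (hf : ∀ x, a ≤ x → HasDerivAt f (f' x) x) (hf' : ∀ x, a ≤ x → 0 ≤ f' x) :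
    MonotoneOn f (Ici a) := by
  refine monotoneOn_of_deriv_nonneg (convex_Ici a)
    (fun x hx => (hf x hx).continuousAt.continuousWithinAt)
    (fun x hx => (hf x (interior_subset hx)).differentiableAt.differentiableWithinAt)
    fun x hx => ?_
  rw [(hf x (interior_subset hx)).deriv]
  exact hf' x (interior_subset hx)

section ModifiedBesselEquation

/-! Monotone energies for solutions of the system `du/dx = p`, `dp/dx = -(1 - μ / x²) u`. -/

variable {u p : ℝ → ℝ} {μ : ℝ}

theorem hasDerivAt_one_sub_div_sq {x : ℝ} (μ : ℝ) (hx : 0 < x) :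
    HasDerivAt (fun x => 1 - μ / x ^ 2) (2 * μ / x ^ 3) x := by
  have h := ((hasDerivAt_pow 2 x).fun_inv (by positivity)).const_mul μ |>.const_sub 1
  simp only [← div_eq_mul_inv] at h
  refine h.congr_deriv ?_
  field_simp
  norm_num
  ring

/-- With `Q = 1 - μ/x²`, the cross terms `2Qup` cancel and the derivative is `Q' u²`, where `Q' =
2μ/x³ ≥ 0`. -/
theorem monotoneOn_energy (hu : ∀ x, 0 < x → HasDerivAt u (p x) x)
    (hp : ∀ x, 0 < x → HasDerivAt p (-((1 - μ / x ^ 2) * u x)) x)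
    (hμ : 0 ≤ μ) {a : ℝ} (ha : 0 < a) :
    MonotoneOn (fun x => (1 - μ / x ^ 2) * u x ^ 2 + p x ^ 2) (Ici a) := by
  refine monotoneOn_Ici_of_hasDerivAt (f' := fun x => 2 * μ / x ^ 3 * u x ^ 2) (fun x hx => ?_)
    fun x hx => ?_
  · have hx0 : 0 < x := ha.trans_le hx
    refine (((hasDerivAt_one_sub_div_sq μ hx0).fun_mul ((hu x hx0).fun_pow 2)).fun_add
      ((hp x hx0).fun_pow 2)).congr_deriv ?_
    norm_num
    ring
  · have hx0 : 0 < x := ha.trans_le hx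
    positivity

/-- Dividing the previous energy by `Q > 0` reverses the sign: the derivative is `-Q' p² / Q²`. -/
theorem antitoneOn_energy (hu : ∀ x, 0 < x → HasDerivAt u (p x) x)
    (hp : ∀ x, 0 < x → HasDerivAt p (-((1 - μ / x ^ 2) * u x)) x)
    (hμ : 0 ≤ μ) {a : ℝ} (ha : 0 < a) (haμ : μ < a ^ 2) :
    AntitoneOn (fun x => u x ^ 2 + p x ^ 2 / (1 - μ / x ^ 2)) (Ici a) := by
  rw [← neg_neg (fun x => u x ^ 2 + p x ^ 2 / (1 - μ / x ^ 2))]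
  refine (monotoneOn_Ici_of_hasDerivAt
    (f' := fun x => p x ^ 2 * (2 * μ / x ^ 3) / (1 - μ / x ^ 2) ^ 2) (fun x hx => ?_)
    fun x hx => ?_).neg
  · have hx0 : 0 < x := ha.trans_le hx
    have hQ : 1 - μ / x ^ 2 ≠ 0 := by
      have : μ / x ^ 2 < 1 := by
        rw [div_lt_one (by positivity)]
        exact haμ.trans_le (pow_le_pow_left₀ ha.le hx 2)
      linarith
    refine (((hu x hx0).fun_pow 2).fun_add (((hp x hx0).fun_pow 2).fun_div
      (hasDerivAt_one_sub_div_sq μ hx0) hQ)).neg.congr_deriv ?_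
    generalize 2 * μ / x ^ 3 = q'
    generalize 1 - μ / x ^ 2 = q at hQ
    field_simp
    norm_num
    ring
  · have hx0 : 0 < x := ha.trans_le hx
    positivity

/-- The adiabatic invariant of the equation with potential `1 - μ / x²`, with its first
correction. -/
noncomputable def adiabaticEnergy (u p : ℝ → ℝ) (μ x : ℝ) : ℝ :=
  √(x ^ 2 - μ) / x * u x ^ 2 + x / √(x ^ 2 - μ) * p x ^ 2 + μ / √(x ^ 2 - μ) ^ 3 * (u x * p x)

/-- The two main terms have product `(up)²`, so they sum to at least `2|up|`; the condition `μ ≤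
S³`, with `S = √(x² - μ)`, keeps the correction below `|up|`, at most half of that sum. -/
theorem half_le_adiabaticEnergy {x : ℝ} (hx : 0 < x) (hμ : 0 ≤ μ) (hxμ : μ < x ^ 2)
    (hS : μ ≤ √(x ^ 2 - μ) ^ 3) :
    √(x ^ 2 - μ) / x * u x ^ 2 + x / √(x ^ 2 - μ) * p x ^ 2 ≤ 2 * adiabaticEnergy u p μ x ∧
      u x * p x ≤ adiabaticEnergy u p μ x ∧
      adiabaticEnergy u p μ x ≤
        2 * (√(x ^ 2 - μ) / x * u x ^ 2 + x / √(x ^ 2 - μ) * p x ^ 2) := by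
  unfold adiabaticEnergy
  have hS0 : 0 < √(x ^ 2 - μ) := Real.sqrt_pos.2 (by linarith)
  set S := √(x ^ 2 - μ)
  have h1 : 2 * |u x * p x| ≤ S / x * u x ^ 2 + x / S * p x ^ 2 := by
    rw [abs_mul]
    have e : S / x * u x ^ 2 + x / S * p x ^ 2 - 2 * (|u x| * |p x|)
        = (S * |u x| - x * |p x|) ^ 2 / (S * x) := by
      rw [← sq_abs (u x), ← sq_abs (p x)]
      field_simp
      ring
    have : 0 ≤ (S * |u x| - x * |p x|) ^ 2 / (S * x) := by positivity
    linarith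
  have h2 : |μ / S ^ 3 * (u x * p x)| ≤ |u x * p x| := by
    rw [abs_mul, abs_of_nonneg (by positivity : 0 ≤ μ / S ^ 3)]
    refine mul_le_of_le_one_left (abs_nonneg _) ?_
    rwa [div_le_one (by positivity)]
  have h3 := abs_le.1 h2
  have h4 := le_abs_self (u x * p x)
  have h5 := abs_nonneg (u x * p x)
  refine ⟨by linarith, by linarith, by linarith⟩

/-- Let `S = √(x² - μ)` and `ω = S/x`, so `ω'/ω² = μ/S³`. The correction cancels every term in `ω'`,
leaving only `(μ/S³)' u p` as derivative. Since `up` is at most the energy, the integrating factor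
`exp(-μ/S³)` makes the product increasing. -/
theorem monotoneOn_adiabaticEnergy (hu : ∀ x, 0 < x → HasDerivAt u (p x) x)
    (hp : ∀ x, 0 < x → HasDerivAt p (-((1 - μ / x ^ 2) * u x)) x)
    (hμ : 0 ≤ μ) {a : ℝ} (ha : 0 < a) (haμ : μ < a ^ 2) (hS : μ ≤ √(a ^ 2 - μ) ^ 3) :
    MonotoneOn (fun x => adiabaticEnergy u p μ x * Real.exp (-(μ / √(x ^ 2 - μ) ^ 3)))
      (Ici a) := by
  refine monotoneOn_Ici_of_hasDerivAt
    (f' := fun x => 3 * μ * x / √(x ^ 2 - μ) ^ 5 * Real.exp (-(μ / √(x ^ 2 - μ) ^ 3)) *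
      (adiabaticEnergy u p μ x - u x * p x)) (fun x hx => ?_)
    fun x hx => ?_
  · have hx0 : 0 < x := ha.trans_le hx
    have hxμ : μ < x ^ 2 := haμ.trans_le (pow_le_pow_left₀ ha.le hx 2)
    have hR : 0 < x ^ 2 - μ := by linarith
    have hS0 : 0 < √(x ^ 2 - μ) := Real.sqrt_pos.2 hR
    have hSd : HasDerivAt (fun x => √(x ^ 2 - μ)) (x / √(x ^ 2 - μ)) x := by
      refine (((hasDerivAt_pow 2 x).sub_const μ).sqrt hR.ne').congr_deriv ?_
      field_simp
      norm_num
    have hSq : √(x ^ 2 - μ) ^ 2 = x ^ 2 - μ := Real.sq_sqrt hR.le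
    have hμe : μ = x ^ 2 - √(x ^ 2 - μ) ^ 2 := by rw [hSq]; ring
    have h3 : HasDerivAt (fun x => μ / √(x ^ 2 - μ) ^ 3) (-(3 * μ * x / √(x ^ 2 - μ) ^ 5)) x := by
      refine ((hasDerivAt_const x μ).fun_div (hSd.fun_pow 3) (by positivity)).congr_deriv ?_
      field_simp
      norm_num
      ring
    have hH : HasDerivAt (adiabaticEnergy u p μ)
        (-(3 * μ * x / √(x ^ 2 - μ) ^ 5) * (u x * p x)) x := by
      have h1 := hSd.fun_div (hasDerivAt_id' x) hx0.ne'
      have h2 := (hasDerivAt_id' x).fun_div hSd hS0.ne'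
      refine (((h1.fun_mul ((hu x hx0).fun_pow 2)).fun_add
        (h2.fun_mul ((hp x hx0).fun_pow 2))).fun_add
        (h3.fun_mul ((hu x hx0).fun_mul (hp x hx0)))).congr_deriv ?_
      generalize √(x ^ 2 - μ) = S at *
      subst hμe
      field_simp
      norm_num
      ring
    refine (hH.fun_mul h3.fun_neg.exp).congr_deriv ?_
    ring
  · have hx0 : 0 < x := ha.trans_le hx
    have hxμ : μ < x ^ 2 := haμ.trans_le (pow_le_pow_left₀ ha.le hx 2)
    have hS' : μ ≤ √(x ^ 2 - μ) ^ 3 := hS.trans (by gcongr)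
    have := (half_le_adiabaticEnergy (u := u) (p := p) hx0 hμ hxμ hS').2.1
    exact mul_nonneg (by positivity) (sub_nonneg.2 this)

end ModifiedBesselEquation
-- Amplitude at infinity, uniformly in the order
open Filter

theorem abs_besselJTilde_four_le {ν : ℝ} (hν : 1 ≤ ν) (hν3 : ν ≤ 3) :
    |besselJTilde ν 4| ≤ 16 * Real.exp 4 := by
  rw [besselJTilde_eq, show (4 : ℝ) = 2 ^ 2 by norm_num, Real.sqrt_sq (by norm_num),
    show ((2 : ℝ) ^ 2 / 2) = 2 by norm_num, abs_mul, abs_mul, abs_two,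
    abs_of_pos (by positivity : (0 : ℝ) < 2 ^ ν)]
  have h1 : (2 : ℝ) ^ ν ≤ 8 := by
    calc (2 : ℝ) ^ ν ≤ 2 ^ (3 : ℝ) := Real.rpow_le_rpow_of_exponent_le (by norm_num) hν3
      _ = 8 := by norm_num
  have h2 := abs_besselSeries_le hν (2 ^ 2)
  rw [abs_of_pos (by norm_num : (0 : ℝ) < 2 ^ 2)] at h2
  nlinarith [mul_le_mul h1 h2 (abs_nonneg _) (by norm_num), Real.exp_pos (2 ^ 2)]

/-- For these orders `μ < 4`, so `x = 4` lies past the turning point. The series bounds the data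
there, and the decreasing energy propagates the bound to all larger `x`. -/
theorem exists_amplitude_bound_of_le_two :
    ∃ A : ℝ, 0 < A ∧ ∀ ν : ℝ, 1 ≤ ν → ν ≤ 2 → ∀ x : ℝ, 4 ≤ x →
      besselJTilde ν x ^ 2 + besselJTilde (ν + 1) x ^ 2 ≤ A := by
  set B := 16 * Real.exp 4 with hB
  have hB0 : 0 < B := by positivity
  refine ⟨40 * B ^ 2, by positivity, fun ν h1 h2 x hx => ?_⟩
  have hμ : 0 ≤ ν ^ 2 - 1 / 4 := by nlinarith
  have hμ4 : ν ^ 2 - 1 / 4 ≤ 4 := by nlinarith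
  have hx0 : 0 < x := by linarith
  have hE := antitoneOn_energy (u := besselJTilde ν) (p := besselJTildeDeriv ν)
    (fun x hx => hasDerivAt_besselJTilde h1 hx) (fun x hx => hasDerivAt_besselJTildeDeriv h1 hx)
    hμ (a := 4) (by norm_num) (by linarith) (show (4 : ℝ) ∈ Ici 4 by simp)
    (show x ∈ Ici 4 from hx) hx
  simp only at hE
  have hu4 := abs_besselJTilde_four_le h1 (by linarith : ν ≤ 3)
  have hw4 := abs_besselJTilde_four_le (by linarith : 1 ≤ ν + 1) (by linarith : ν + 1 ≤ 3)
  rw [← hB] at hu4 hw4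
  have hp4 : |besselJTildeDeriv ν 4| ≤ 2 * B := by
    unfold besselJTildeDeriv
    refine (abs_sub _ _).trans ?_
    rw [abs_mul, abs_of_nonneg (by positivity : 0 ≤ (ν + 1 / 2) / 4)]
    have : (ν + 1 / 2) / 4 ≤ 1 := by linarith
    nlinarith [abs_nonneg (besselJTilde ν 4)]
  have hE4 : besselJTilde ν 4 ^ 2 + besselJTildeDeriv ν 4 ^ 2 / (1 - (ν ^ 2 - 1 / 4) / 4 ^ 2)
      ≤ 9 * B ^ 2 := by
    have a1 : besselJTilde ν 4 ^ 2 ≤ B ^ 2 := sq_le_sq' (abs_le.1 hu4).1 (abs_le.1 hu4).2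
    have a2 : besselJTildeDeriv ν 4 ^ 2 ≤ (2 * B) ^ 2 :=
      sq_le_sq' (abs_le.1 hp4).1 (abs_le.1 hp4).2
    have a3 : besselJTildeDeriv ν 4 ^ 2 / (1 - (ν ^ 2 - 1 / 4) / 4 ^ 2) ≤ 8 * B ^ 2 := by
      rw [div_le_iff₀ (by linarith)]
      nlinarith [sq_nonneg B]
    linarith
  have hQ : (ν ^ 2 - 1 / 4) / x ^ 2 < 1 := by
    rw [div_lt_one (by positivity)]; nlinarith
  have hQ0 : 0 ≤ (ν ^ 2 - 1 / 4) / x ^ 2 := by positivity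
  have hp : besselJTildeDeriv ν x ^ 2
      ≤ besselJTildeDeriv ν x ^ 2 / (1 - (ν ^ 2 - 1 / 4) / x ^ 2) := by
    rw [le_div_iff₀ (by linarith)]
    exact mul_le_of_le_one_right (sq_nonneg _) (by linarith)
  have hw : besselJTilde (ν + 1) x = (ν + 1 / 2) / x * besselJTilde ν x - besselJTildeDeriv ν x := by
    unfold besselJTildeDeriv; ring
  have hk : (ν + 1 / 2) / x ≤ 1 := by rw [div_le_one hx0]; linarith
  have hk0 : 0 ≤ (ν + 1 / 2) / x := by positivity
  have hk2 : ((ν + 1 / 2) / x) ^ 2 * besselJTilde ν x ^ 2 ≤ besselJTilde ν x ^ 2 :=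
    mul_le_of_le_one_left (sq_nonneg _) (pow_le_one₀ hk0 hk)
  rw [hw]
  nlinarith [sq_nonneg ((ν + 1 / 2) / x * besselJTilde ν x + besselJTildeDeriv ν x),
    sq_nonneg (besselJTilde ν x), sq_nonneg (besselJTildeDeriv ν x)]

/-- In `J̃_{ν+2} = c J̃_{ν+1} - J̃_ν` the coefficient `c = 2(ν+1)/x` tends to `0`. Allowing every `ε
> 0` keeps `A` unchanged through arbitrarily many steps. -/
theorem eventually_amplitude_succ {ν A : ℝ} (hν : 1 ≤ ν)
    (h : ∀ ε > 0, ∀ᶠ x in atTop, besselJTilde ν x ^ 2 + besselJTilde (ν + 1) x ^ 2 ≤ A + ε) :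
    ∀ ε > 0, ∀ᶠ x in atTop,
      besselJTilde (ν + 1) x ^ 2 + besselJTilde (ν + 1 + 1) x ^ 2 ≤ A + ε := by
  intro ε hε
  set M := max (A + 1) 1
  have hM : 0 < M := lt_max_of_lt_right one_pos
  have hc : Tendsto (fun x : ℝ => 2 * (ν + 1) / x) atTop (nhds 0) :=
    tendsto_const_nhds.div_atTop tendsto_id
  filter_upwards [h 1 one_pos, h (ε / 2) (by linarith), eventually_gt_atTop 0,
    hc.eventually_lt_const one_pos,
    hc.eventually_lt_const (show 0 < ε / (4 * M) by positivity)] with x h1 h2 hx hc1 hc2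
  have hM1 : A + 1 ≤ M := le_max_left _ _
  rw [show ν + 1 + 1 = ν + 2 by ring, besselJTilde_recurrence hν hx]
  have hc0 : 0 < 2 * (ν + 1) / x := by positivity
  rw [lt_div_iff₀ (by positivity)] at hc2
  generalize 2 * (ν + 1) / x = c at *
  generalize besselJTilde ν x = a at *
  generalize besselJTilde (ν + 1) x = b at *
  have e1 : -(2 * (a * b)) ≤ M := by nlinarith [sq_nonneg (a + b)]
  have e2 : b ^ 2 ≤ M := by nlinarith [sq_nonneg a]
  have e3 : c * -(2 * (a * b)) ≤ c * M := mul_le_mul_of_nonneg_left e1 hc0.le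
  have e4 : c ^ 2 * b ^ 2 ≤ c * M :=
    mul_le_mul (by nlinarith) e2 (sq_nonneg _) hc0.le
  nlinarith

theorem exists_eventually_amplitude_bound :
    ∃ A : ℝ, 0 < A ∧ ∀ ν : ℝ, 1 ≤ ν → ∀ᶠ x in atTop,
      besselJTilde ν x ^ 2 + besselJTilde (ν + 1) x ^ 2 ≤ A := by
  obtain ⟨A, hA, h⟩ := exists_amplitude_bound_of_le_two
  have key : ∀ n : ℕ, ∀ ν : ℝ, 1 ≤ ν → ν ≤ 2 → ∀ ε > 0, ∀ᶠ x in atTop,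
      besselJTilde (ν + n) x ^ 2 + besselJTilde (ν + n + 1) x ^ 2 ≤ A + ε := by
    intro n
    induction n with
    | zero =>
      intro ν h1 h2 ε hε
      filter_upwards [eventually_ge_atTop 4] with x hx
      have := h ν h1 h2 x hx
      simp only [Nat.cast_zero, add_zero]
      linarith
    | succ n ih =>
      intro ν h1 h2
      have hn : (0 : ℝ) ≤ n := Nat.cast_nonneg n
      have := eventually_amplitude_succ (by linarith) (ih ν h1 h2)
      simpa only [Nat.cast_succ, ← add_assoc] using this
  refine ⟨A + 1, by linarith, fun ν hν => ?_⟩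
  -- Subtracting `⌊ν - 1⌋` brings the order into `[1, 2]`.
  have hf := Nat.floor_le (show 0 ≤ ν - 1 by linarith)
  have hf' := Nat.lt_floor_add_one (ν - 1)
  have := key ⌊ν - 1⌋₊ (ν - ⌊ν - 1⌋₊) (by linarith) (by linarith) 1 one_pos
  simpa only [sub_add_cancel] using this

/-- A bound for the adiabatic energy of `besselJTilde ν` that is uniform in the order. -/
theorem exists_adiabaticEnergy_bound :
    ∃ B : ℝ, 0 < B ∧ ∀ ν : ℝ, 1 ≤ ν → ∀ x : ℝ, 0 < x → ν ^ 2 - 1 / 4 < x ^ 2 →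
      ν ^ 2 - 1 / 4 ≤ √(x ^ 2 - (ν ^ 2 - 1 / 4)) ^ 3 →
      adiabaticEnergy (besselJTilde ν) (besselJTildeDeriv ν) (ν ^ 2 - 1 / 4) x ≤ B := by
  obtain ⟨A, hA, h⟩ := exists_eventually_amplitude_bound
  refine ⟨20 * A * Real.exp 1, by positivity, fun ν hν x hx hxμ hS => ?_⟩
  have hμ : 0 ≤ ν ^ 2 - 1 / 4 := by nlinarith
  -- The point `X` may depend on `ν`, but the energy bound there does not: `X ≥ 2ν` makes `√(X² -
  -- μ)` comparable to `X`.
  obtain ⟨X, hXA, hXx, hXν⟩ := ((h ν hν).and ((eventually_ge_atTop x).and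
    (eventually_ge_atTop (2 * ν)))).exists
  have hX0 : 0 < X := by linarith
  have hmono := monotoneOn_adiabaticEnergy (u := besselJTilde ν) (p := besselJTildeDeriv ν)
    (fun x hx => hasDerivAt_besselJTilde hν hx) (fun x hx => hasDerivAt_besselJTildeDeriv hν hx)
    hμ hx hxμ hS (show x ∈ Ici x by simp) (show X ∈ Ici x from hXx) hXx
  simp only at hmono
  have hp : besselJTildeDeriv ν X ^ 2 ≤ 2 * A := by
    unfold besselJTildeDeriv
    have hk : (ν + 1 / 2) / X ≤ 1 := by rw [div_le_one hX0]; linarith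
    have hk0 : 0 ≤ (ν + 1 / 2) / X := by positivity
    have hk2 : ((ν + 1 / 2) / X) ^ 2 * besselJTilde ν X ^ 2 ≤ besselJTilde ν X ^ 2 :=
      mul_le_of_le_one_left (sq_nonneg _) (pow_le_one₀ hk0 hk)
    nlinarith [sq_nonneg ((ν + 1 / 2) / X * besselJTilde ν X + besselJTilde (ν + 1) X)]
  have hμX : ν ^ 2 - 1 / 4 ≤ X ^ 2 / 4 := by nlinarith
  generalize ν ^ 2 - 1 / 4 = μ at *
  have hu : besselJTilde ν X ^ 2 ≤ A := by nlinarith [sq_nonneg (besselJTilde (ν + 1) X)]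
  have hSX : μ ≤ √(X ^ 2 - μ) ^ 3 := hS.trans (by gcongr)
  have hSle : √(X ^ 2 - μ) ≤ X := Real.sqrt_le_iff.2 ⟨hX0.le, by linarith⟩
  have hleS : X / 2 ≤ √(X ^ 2 - μ) := Real.le_sqrt_of_sq_le (by nlinarith)
  have hS0 : 0 < √(X ^ 2 - μ) := by linarith
  have hX := (half_le_adiabaticEnergy (u := besselJTilde ν) (p := besselJTildeDeriv ν)
    hX0 hμ (by nlinarith) hSX).2.2
  have hx' := (half_le_adiabaticEnergy (u := besselJTilde ν) (p := besselJTildeDeriv ν)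
    hx hμ hxμ hS).1
  have b1 : √(X ^ 2 - μ) / X * besselJTilde ν X ^ 2 ≤ 1 * A :=
    mul_le_mul ((div_le_one hX0).2 hSle) hu (sq_nonneg _) one_pos.le
  have b2 : X / √(X ^ 2 - μ) * besselJTildeDeriv ν X ^ 2 ≤ 2 * (2 * A) :=
    mul_le_mul ((div_le_iff₀ hS0).2 (by linarith)) hp (sq_nonneg _) zero_le_two
  have hHx : 0 ≤ adiabaticEnergy (besselJTilde ν) (besselJTildeDeriv ν) μ x := by
    have : 0 ≤ √(x ^ 2 - μ) / x * besselJTilde ν x ^ 2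
      + x / √(x ^ 2 - μ) * besselJTildeDeriv ν x ^ 2 := by positivity
    linarith
  have hHX : adiabaticEnergy (besselJTilde ν) (besselJTildeDeriv ν) μ X ≤ 20 * A := by linarith
  have hexp : Real.exp (-(μ / √(X ^ 2 - μ) ^ 3)) ≤ 1 :=
    Real.exp_le_one_iff.2 (neg_nonpos.2 (by positivity))
  have hexp' : Real.exp (-1) ≤ Real.exp (-(μ / √(x ^ 2 - μ) ^ 3)) := by
    have : 0 < √(x ^ 2 - μ) := Real.sqrt_pos.2 (by linarith)
    exact Real.exp_le_exp.2 (neg_le_neg ((div_le_one (by positivity)).2 hS))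
  have hfin : adiabaticEnergy (besselJTilde ν) (besselJTildeDeriv ν) μ x * Real.exp (-1)
      ≤ 20 * A :=
    calc _ ≤ _ := mul_le_mul_of_nonneg_left hexp' hHx
      _ ≤ _ := hmono
      _ ≤ 20 * A * Real.exp (-(μ / √(X ^ 2 - μ) ^ 3)) :=
          mul_le_mul_of_nonneg_right hHX (Real.exp_pos _).le
      _ ≤ 20 * A := mul_le_of_le_one_right (by positivity) hexp
  rwa [Real.exp_neg, ← div_eq_mul_inv, div_le_iff₀ (Real.exp_pos 1)] at hfin

/-! ### Pointwise bounds past the turning point -/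

theorem abs_sub_le_of_hasDerivAt {f f' : ℝ → ℝ} {a b K : ℝ} (hab : a ≤ b)
    (hf : ∀ x ∈ Icc a b, HasDerivAt f (f' x) x) (hK : ∀ x ∈ Icc a b, |f' x| ≤ K) :
    |f b - f a| ≤ K * (b - a) := by
  have := (convex_Icc a b).norm_image_sub_le_of_norm_hasDerivWithin_le
    (fun x hx => (hf x hx).hasDerivWithinAt) hK (left_mem_Icc.2 hab) (right_mem_Icc.2 hab)
  rwa [Real.norm_eq_abs, Real.norm_eq_abs, abs_of_nonneg (sub_nonneg.2 hab)] at this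

/-- Bounds beyond the turning point, at distance at least `h = ν ^ (1 / 3)`. -/
theorem exists_besselJTilde_bound_far :
    ∃ B : ℝ, 0 < B ∧ ∀ h : ℝ, 1 ≤ h → ∀ x : ℝ, h ^ 3 + h ≤ x → x ≤ 2 * h ^ 3 →
      besselJTilde (h ^ 3) x ^ 4 * (x - h ^ 3) ≤ 8 * B ^ 2 * h ^ 3 ∧
      √(x ^ 2 - ((h ^ 3) ^ 2 - 1 / 4)) / x * besselJTilde (h ^ 3) x ^ 2
        + x / √(x ^ 2 - ((h ^ 3) ^ 2 - 1 / 4)) * besselJTildeDeriv (h ^ 3) x ^ 2 ≤ 2 * B := by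
  obtain ⟨B, hB, hbound⟩ := exists_adiabaticEnergy_bound
  refine ⟨B, hB, ?_⟩
  intro h hh x hx hx2
  have hν : 1 ≤ h ^ 3 := one_le_pow₀ hh
  have hx0 : 0 < x := by linarith
  have hR : 2 * h ^ 3 * (x - h ^ 3) ≤ x ^ 2 - ((h ^ 3) ^ 2 - 1 / 4) := by
    nlinarith [sq_nonneg (x - h ^ 3)]
  have hR2 : 2 * h ^ 4 ≤ x ^ 2 - ((h ^ 3) ^ 2 - 1 / 4) :=
    le_trans (by nlinarith [mul_le_mul_of_nonneg_left hx (by positivity : 0 ≤ 2 * h ^ 3)]) hR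
  have hS : h ^ 2 ≤ √(x ^ 2 - ((h ^ 3) ^ 2 - 1 / 4)) :=
    Real.le_sqrt_of_sq_le (by nlinarith [pow_nonneg (by linarith : 0 ≤ h) 4])
  -- The distance `h = ν^(1/3)` gives `S ≥ h²`, hence `S³ ≥ h⁶ = ν² > μ`, the condition for the
  -- adiabatic estimate.
  have hS3 : (h ^ 3) ^ 2 - 1 / 4 ≤ √(x ^ 2 - ((h ^ 3) ^ 2 - 1 / 4)) ^ 3 := by
    have := pow_le_pow_left₀ (by positivity) hS 3
    nlinarith
  have h4 : 0 < h ^ 4 := by positivity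
  have hμ : 0 ≤ (h ^ 3) ^ 2 - 1 / 4 := by nlinarith
  have hE := hbound (h ^ 3) hν x hx0 (by linarith) hS3
  have hE2 := (half_le_adiabaticEnergy (u := besselJTilde (h ^ 3))
    (p := besselJTildeDeriv (h ^ 3)) hx0 hμ (by linarith) hS3).1
  have hS0 : 0 < √(x ^ 2 - ((h ^ 3) ^ 2 - 1 / 4)) := lt_of_lt_of_le (by positivity) hS
  have hSq := Real.sq_sqrt (show 0 ≤ x ^ 2 - ((h ^ 3) ^ 2 - 1 / 4) by linarith)
  generalize √(x ^ 2 - ((h ^ 3) ^ 2 - 1 / 4)) = S at *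
  refine ⟨?_, by linarith⟩
  have hp0 : 0 ≤ x / S * besselJTildeDeriv (h ^ 3) x ^ 2 := by positivity
  have hu : S * besselJTilde (h ^ 3) x ^ 2 ≤ 2 * B * x := by
    rw [← div_le_iff₀ hx0, mul_div_right_comm]
    linarith
  have hu2 : S ^ 2 * besselJTilde (h ^ 3) x ^ 4 ≤ 4 * B ^ 2 * x ^ 2 := by
    have := pow_le_pow_left₀ (by positivity) hu 2
    nlinarith
  have hu3 : 2 * h ^ 3 * (x - h ^ 3) * besselJTilde (h ^ 3) x ^ 4 ≤ 4 * B ^ 2 * (2 * h ^ 3) ^ 2 :=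
    calc _ ≤ S ^ 2 * besselJTilde (h ^ 3) x ^ 4 := by rw [hSq]; gcongr
      _ ≤ 4 * B ^ 2 * x ^ 2 := hu2
      _ ≤ _ := by gcongr
  have h3 : 0 < 2 * h ^ 3 := by positivity
  refine le_of_mul_le_mul_left ?_ h3
  nlinarith

/-- The bound beyond the turning point, in terms of `h = ν ^ (1 / 3)`. -/
theorem exists_besselJTilde_fourth_power_bound :
    ∃ C : ℝ, 0 < C ∧ ∀ h : ℝ, 1 ≤ h → ∀ x : ℝ, h ^ 3 < x → x ≤ 2 * h ^ 3 →
      besselJTilde (h ^ 3) x ^ 4 * (x - h ^ 3) ≤ C * h ^ 3 := by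
  obtain ⟨B, hB, far⟩ := exists_besselJTilde_bound_far
  refine ⟨256 * B ^ 2, by positivity, fun h hh x hx hx2 => ?_⟩
  have hν : 1 ≤ h ^ 3 := one_le_pow₀ hh
  have hh0 : 0 < h := by linarith
  rcases le_or_gt (h ^ 3 + h) x with hxh | hxh
  · refine (far h hh x hxh hx2).1.trans ?_
    gcongr
    norm_num
  -- Closer than `h`, values are compared with those at `x₁`. There `S` is of size `h²`, so `u² ≤
  -- 4Bh` and the increasing energy is at most `4B/h`.
  set x₁ := h ^ 3 + h with hx₁
  have hx₁0 : 0 < x₁ := by positivity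
  have hx0 : 0 < x := by linarith
  have hhh : h ≤ h ^ 3 := le_self_pow₀ hh three_ne_zero
  have hE := (far h hh x₁ le_rfl (by linarith)).2
  have hμ : 0 ≤ (h ^ 3) ^ 2 - 1 / 4 := by nlinarith
  have hF := monotoneOn_energy (u := besselJTilde (h ^ 3)) (p := besselJTildeDeriv (h ^ 3))
    (fun x hx => hasDerivAt_besselJTilde hν hx) (fun x hx => hasDerivAt_besselJTildeDeriv hν hx)
    hμ (a := h ^ 3) (by positivity)
  have hRe : x₁ ^ 2 - ((h ^ 3) ^ 2 - 1 / 4) = 2 * h ^ 4 + h ^ 2 + 1 / 4 := by rw [hx₁]; ring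
  have h21 : 1 ≤ h ^ 2 := one_le_pow₀ hh
  have hR0 : 0 ≤ x₁ ^ 2 - ((h ^ 3) ^ 2 - 1 / 4) := by rw [hRe]; positivity
  have hSlo : h ^ 2 ≤ √(x₁ ^ 2 - ((h ^ 3) ^ 2 - 1 / 4)) :=
    Real.le_sqrt_of_sq_le (by rw [hRe]; nlinarith)
  have hShi : √(x₁ ^ 2 - ((h ^ 3) ^ 2 - 1 / 4)) ≤ 2 * h ^ 2 :=
    Real.sqrt_le_iff.2 ⟨by positivity, by rw [hRe]; nlinarith⟩
  have hQ : 1 - ((h ^ 3) ^ 2 - 1 / 4) / x₁ ^ 2 =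
      (√(x₁ ^ 2 - ((h ^ 3) ^ 2 - 1 / 4)) / x₁) ^ 2 := by
    rw [div_pow, Real.sq_sqrt hR0]
    field_simp
  have hS0 : 0 < √(x₁ ^ 2 - ((h ^ 3) ^ 2 - 1 / 4)) := lt_of_lt_of_le (by positivity) hSlo
  generalize √(x₁ ^ 2 - ((h ^ 3) ^ 2 - 1 / 4)) = S at *
  have hSx : S / x₁ ≤ 2 / h := by
    rw [div_le_div_iff₀ hx₁0 hh0]
    nlinarith
  have hF₁ : (1 - ((h ^ 3) ^ 2 - 1 / 4) / x₁ ^ 2) * besselJTilde (h ^ 3) x₁ ^ 2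
      + besselJTildeDeriv (h ^ 3) x₁ ^ 2 ≤ 4 * B / h := by
    rw [hQ]
    calc _ = S / x₁ * (S / x₁ * besselJTilde (h ^ 3) x₁ ^ 2
          + x₁ / S * besselJTildeDeriv (h ^ 3) x₁ ^ 2) := by field_simp
      _ ≤ 2 / h * (2 * B) := by gcongr
      _ = _ := by ring
  have hu₁ : besselJTilde (h ^ 3) x₁ ^ 2 ≤ 4 * B * h := by
    have hp0 : 0 ≤ x₁ / S * besselJTildeDeriv (h ^ 3) x₁ ^ 2 := by positivity
    have hu : S * besselJTilde (h ^ 3) x₁ ^ 2 ≤ 2 * B * x₁ := by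
      rw [← div_le_iff₀ hx₁0, mul_div_right_comm]
      linarith
    have hu' : h ^ 2 * besselJTilde (h ^ 3) x₁ ^ 2 ≤ h ^ 2 * (4 * B * h) :=
      calc _ ≤ S * besselJTilde (h ^ 3) x₁ ^ 2 := by gcongr
        _ ≤ 2 * B * x₁ := hu
        _ ≤ 2 * B * (2 * h ^ 3) := by gcongr; linarith
        _ = _ := by ring
    exact le_of_mul_le_mul_left hu' (by positivity)
  -- For `z ≥ h³` the potential term is nonnegative, so the energy at `x₁` bounds `p²`. Over a
  -- length at most `h`, `u` then varies by at most `√(4Bh)`.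
  have hp : ∀ z ∈ Icc x x₁, |besselJTildeDeriv (h ^ 3) z| ≤ √(4 * B / h) := by
    intro z hz
    have hzν : h ^ 3 ≤ z := hx.le.trans hz.1
    have h1 := hF (show z ∈ Ici _ from hzν) (show x₁ ∈ Ici _ from hzν.trans hz.2) hz.2
    simp only at h1
    have hz0 : 0 < z := hx0.trans_le hz.1
    have hQz : 0 ≤ 1 - ((h ^ 3) ^ 2 - 1 / 4) / z ^ 2 := by
      rw [sub_nonneg, div_le_one (by positivity)]
      nlinarith
    have h2 := mul_nonneg hQz (sq_nonneg (besselJTilde (h ^ 3) z))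
    exact Real.abs_le_sqrt (by linarith)
  have hdiff := abs_sub_le_of_hasDerivAt hxh.le
    (fun z hz => hasDerivAt_besselJTilde hν (hx0.trans_le hz.1)) hp
  have hdiff2 : (besselJTilde (h ^ 3) x₁ - besselJTilde (h ^ 3) x) ^ 2 ≤ 4 * B * h := by
    rw [← sq_abs]
    calc _ ≤ (√(4 * B / h) * h) ^ 2 := by
          refine pow_le_pow_left₀ (abs_nonneg _) (hdiff.trans ?_) 2
          gcongr
          linarith
      _ = _ := by
          rw [mul_pow, Real.sq_sqrt (by positivity)]
          field_simp
  have hu : besselJTilde (h ^ 3) x ^ 2 ≤ 16 * B * h := by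
    have e := sq_nonneg (2 * besselJTilde (h ^ 3) x₁ - besselJTilde (h ^ 3) x)
    generalize besselJTilde (h ^ 3) x₁ = a at hu₁ hdiff2 e
    generalize besselJTilde (h ^ 3) x = b at hdiff2 e ⊢
    have e' : b ^ 2 = 2 * a ^ 2 + 2 * (a - b) ^ 2 - (2 * a - b) ^ 2 := by ring
    rw [e']
    linarith only [hu₁, hdiff2, e]
  calc besselJTilde (h ^ 3) x ^ 4 * (x - h ^ 3) = (besselJTilde (h ^ 3) x ^ 2) ^ 2 * (x - h ^ 3) := by
        ring
    _ ≤ (16 * B * h) ^ 2 * h := by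
        gcongr
        linarith
    _ = _ := by ring

/-- A uniform bound for Bessel functions beyond the turning point. -/
theorem exists_abs_besselJTilde_le :
    ∃ C : ℝ, 0 < C ∧ ∀ ν : ℝ, 1 ≤ ν → ∀ x : ℝ, ν < x → x ≤ 2 * ν →
      |besselJTilde ν x| ≤ C * ν ^ (1 / 4 : ℝ) * (x - ν) ^ (-(1 / 4) : ℝ) := by
  obtain ⟨C, hC, hb⟩ := exists_besselJTilde_fourth_power_bound
  refine ⟨C ^ (1 / 4 : ℝ), by positivity, fun ν hν x hx hx2 => ?_⟩
  have hν0 : 0 ≤ ν := by linarith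
  have hc : (ν ^ (1 / 3 : ℝ)) ^ 3 = ν := by
    rw [← Real.rpow_natCast, ← Real.rpow_mul hν0]
    norm_num
  have h := hb (ν ^ (1 / 3 : ℝ)) (Real.one_le_rpow hν (by norm_num)) x
  rw [hc] at h
  have hy : 0 < x - ν := by linarith
  have h' : |besselJTilde ν x| ^ 4 ≤ C * ν / (x - ν) := by
    rw [le_div_iff₀ hy, Even.pow_abs (by decide)]
    exact h hx hx2
  have h4 := Real.rpow_le_rpow (by positivity) h' (by norm_num : (0 : ℝ) ≤ 1 / 4)
  rw [← Real.rpow_natCast, ← Real.rpow_mul (abs_nonneg _), Real.div_rpow (by positivity) hy.le,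
    Real.mul_rpow hC.le hν0, div_eq_mul_inv _ ((x - ν) ^ _), ← Real.rpow_neg hy.le,
    show ((4 : ℕ) : ℝ) * (1 / 4) = 1 by norm_num, Real.rpow_one] at h4
  exact h4

/-! ### Kernel bound and Schur-type estimate -/

/-- The profile `1_{(ν, ν + ν^{2/3}]}(x) (x - ν)^{-1/4}`. -/
noncomputable def transitionProfile (ν : ℝ) : ℝ → ENNReal :=
  (Ioc ν (ν + ν ^ (2 / 3 : ℝ))).indicator fun x => ENNReal.ofReal ((x - ν) ^ (-(1 / 4) : ℝ))

theorem measurable_transitionProfile (ν : ℝ) : Measurable (transitionProfile ν) :=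
  (by fun_prop : Measurable fun x : ℝ => ENNReal.ofReal ((x - ν) ^ (-(1 / 4) : ℝ))).indicator
    measurableSet_Ioc

theorem lintegral_transitionProfile_le {ν : ℝ} (hν : 1 ≤ ν) :
    ∫⁻ x, transitionProfile ν x ≤ ENNReal.ofReal (2 * ν ^ (1 / 2 : ℝ)) := by
  have hν0 : 0 ≤ ν := by linarith
  have hL : 0 ≤ ν ^ (2 / 3 : ℝ) := by positivity
  have hle : ν ≤ ν + ν ^ (2 / 3 : ℝ) := by linarith
  have hi : IntervalIntegrable (fun x => (x - ν) ^ (-(1 / 4) : ℝ)) volume ν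
      (ν + ν ^ (2 / 3 : ℝ)) := by
    have := (intervalIntegral.intervalIntegrable_rpow' (a := 0) (b := ν ^ (2 / 3 : ℝ))
      (r := -(1 / 4)) (by norm_num)).comp_sub_right ν
    rwa [zero_add, add_comm] at this
  rw [intervalIntegrable_iff_integrableOn_Ioc_of_le hle] at hi
  have h0 : 0 ≤ᵐ[volume.restrict (Ioc ν (ν + ν ^ (2 / 3 : ℝ)))]
      fun x => (x - ν) ^ (-(1 / 4) : ℝ) := by
    filter_upwards [ae_restrict_mem measurableSet_Ioc] with x hx
    exact Real.rpow_nonneg (by linarith [hx.1]) _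
  unfold transitionProfile
  rw [lintegral_indicator measurableSet_Ioc, ← ofReal_integral_eq_lintegral_ofReal hi h0,
    ← intervalIntegral.integral_of_le hle,
    intervalIntegral.integral_comp_sub_right (fun x => x ^ (-(1 / 4) : ℝ)), sub_self,
    add_sub_cancel_left, integral_rpow (Or.inl (by norm_num)), ← Real.rpow_mul hν0]
  -- The exact mass is `(4/3) ν^(1/2)`, since `(2/3)(3/4) = 1/2`.
  refine ENNReal.ofReal_le_ofReal ?_
  have : 0 ≤ ν ^ (1 / 2 : ℝ) := by positivity
  norm_num at this ⊢
  linarith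

theorem lintegral_comp_mul_left_real {f : ℝ → ENNReal} (hf : Measurable f) {a : ℝ} (ha : 0 < a) :
    ∫⁻ x, f (a * x) = ENNReal.ofReal a⁻¹ * ∫⁻ x, f x := by
  rw [← lintegral_map hf (measurable_const_mul a), Real.map_volume_mul_left ha.ne',
    lintegral_smul_measure, abs_of_pos (inv_pos.2 ha), smul_eq_mul]

theorem lintegral_mul_sq_le {α : Type*} [MeasurableSpace α] {μ : Measure α} {b f : α → ENNReal}
    (hb : AEMeasurable b μ) (hf : AEMeasurable f μ) :
    (∫⁻ x, b x * f x ∂μ) ^ 2 ≤ (∫⁻ x, b x ∂μ) * ∫⁻ x, b x * f x ^ 2 ∂μ := by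
  have h := ENNReal.lintegral_mul_le_Lp_mul_Lq μ Real.HolderConjugate.two_two
    (hb.pow_const (1 / 2 : ℝ)) ((hb.pow_const (1 / 2 : ℝ)).mul hf)
  have e (x : ENNReal) : (x ^ (1 / 2 : ℝ)) ^ 2 = x := by
    rw [← ENNReal.rpow_natCast, ← ENNReal.rpow_mul]; norm_num
  have e2 (x : ENNReal) : (x ^ (1 / 2 : ℝ)) ^ (2 : ℝ) = x := by
    rw [← ENNReal.rpow_mul]; norm_num
  have e3 (x : α) : b x ^ (1 / 2 : ℝ) * (b x ^ (1 / 2 : ℝ) * f x) = b x * f x := by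
    rw [← mul_assoc, ← sq, e]
  simp only [Pi.mul_apply, e2, e3, ENNReal.mul_rpow_of_nonneg _ _ zero_le_two,
    ENNReal.rpow_two] at h
  calc _ ≤ _ := pow_le_pow_left' h 2
    _ = _ := by rw [mul_pow, e, e]

/-- On the support `ν ≤ rs`, so `ν^(1/4) s^(-1/4) ≤ r^(1/4)`. The point `rs = ν` is excluded because
the profile vanishes there while the kernel need not. -/
theorem enorm_transitionKernel_le {ν C : ℝ} (hν : 1 ≤ ν) (hC : 0 ≤ C)
    (hJ : ∀ x : ℝ, ν < x → x ≤ 2 * ν →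
      |besselJTilde ν x| ≤ C * ν ^ (1 / 4 : ℝ) * (x - ν) ^ (-(1 / 4) : ℝ))
    (t : ℝ → ℝ) {r s : ℝ} (hr : 0 < r) (hrs : r * s ≠ ν) :
    ‖transitionKernel ν t r s‖ₑ ≤
      ENNReal.ofReal C * (ENNReal.ofReal (r ^ (1 / 4 : ℝ)) * transitionProfile ν (r * s)) := by
  have hν0 : 0 < ν := by linarith
  unfold transitionKernel transitionProfile
  by_cases hmem : r * s ∈ Icc ν (ν + ν ^ (2 / 3 : ℝ))
  · have hmem' : r * s ∈ Ioc ν (ν + ν ^ (2 / 3 : ℝ)) := ⟨hmem.1.lt_of_ne' hrs, hmem.2⟩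
    have hs : 0 < s := pos_of_mul_pos_right (hν0.trans hmem'.1) hr.le
    have hL : ν ^ (2 / 3 : ℝ) ≤ ν := by
      calc _ ≤ ν ^ (1 : ℝ) := Real.rpow_le_rpow_of_exponent_le hν (by norm_num)
        _ = ν := Real.rpow_one ν
    rw [indicator_of_mem hmem, indicator_of_mem hmem', enorm_mul, mul_comm Complex.I,
      ← ofReal_norm, Complex.norm_exp_ofReal_mul_I, ENNReal.ofReal_one, one_mul, ← ofReal_norm,
      Complex.norm_real, mul_one, norm_mul, Real.norm_eq_abs,
      Real.norm_of_nonneg (by positivity : 0 ≤ s ^ (-(1 / 4) : ℝ)),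
      ← ENNReal.ofReal_mul (by positivity), ← ENNReal.ofReal_mul hC]
    refine ENNReal.ofReal_le_ofReal ?_
    have h1 := hJ (r * s) hmem'.1 (by linarith [hmem.2])
    have h2 : ν ^ (1 / 4 : ℝ) * s ^ (-(1 / 4) : ℝ) ≤ r ^ (1 / 4 : ℝ) := by
      rw [Real.rpow_neg hs.le, ← div_eq_mul_inv, div_le_iff₀ (by positivity),
        ← Real.mul_rpow hr.le hs.le]
      exact Real.rpow_le_rpow hν0.le hmem.1 (by norm_num)
    have h3 : 0 ≤ (r * s - ν) ^ (-(1 / 4) : ℝ) :=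
      Real.rpow_nonneg (by linarith [hmem.1]) _
    calc _ ≤ C * ν ^ (1 / 4 : ℝ) * (r * s - ν) ^ (-(1 / 4) : ℝ) * s ^ (-(1 / 4) : ℝ) := by gcongr
      _ = C * (ν ^ (1 / 4 : ℝ) * s ^ (-(1 / 4) : ℝ) * (r * s - ν) ^ (-(1 / 4) : ℝ)) := by ring
      _ ≤ _ := by gcongr
  · rw [indicator_of_notMem hmem]
    simp

theorem measurable_transitionWeight (ν : ℝ) :
    Measurable fun q : ℝ × ℝ =>
      ENNReal.ofReal (2 * ν ^ (1 / 2 : ℝ) * q.1 ^ (-(1 / 2) : ℝ)) *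
        transitionProfile ν (q.1 * q.2) :=
  (by fun_prop : Measurable fun q : ℝ × ℝ =>
    ENNReal.ofReal (2 * ν ^ (1 / 2 : ℝ) * q.1 ^ (-(1 / 2) : ℝ))).mul
    ((measurable_transitionProfile ν).comp (measurable_fst.mul measurable_snd))

/-- Cauchy–Schwarz with the kernel as weight. Scaling by `r` bounds the kernel's mass in `s` by `2
ν^(1/2) r^(-3/4)`; the kernel's own factor `r^(1/4)` raises the exponent to `-1/2`. -/
theorem sq_lintegral_transitionProfile_mul_le {ν : ℝ} (hν : 1 ≤ ν) {μ : Measure ℝ}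
    (hμ : μ ≤ volume) {f : ℝ → ENNReal} (hf : AEMeasurable f μ) {r : ℝ} (hr : 0 < r) :
    (∫⁻ s, ENNReal.ofReal (r ^ (1 / 4 : ℝ)) * transitionProfile ν (r * s) * f s ∂μ) ^ 2 ≤
      ∫⁻ s, ENNReal.ofReal (2 * ν ^ (1 / 2 : ℝ) * r ^ (-(1 / 2) : ℝ)) *
        transitionProfile ν (r * s) * f s ^ 2 ∂μ := by
  have hν0 : 0 ≤ ν := by linarith
  have hm : Measurable fun s => transitionProfile ν (r * s) :=
    (measurable_transitionProfile ν).comp (measurable_const_mul r)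
  have hb : ∫⁻ s, ENNReal.ofReal (r ^ (1 / 4 : ℝ)) * transitionProfile ν (r * s) ∂μ ≤
      ENNReal.ofReal (2 * ν ^ (1 / 2 : ℝ) * r ^ (-(3 / 4) : ℝ)) := by
    calc _ ≤ ∫⁻ s, ENNReal.ofReal (r ^ (1 / 4 : ℝ)) * transitionProfile ν (r * s) :=
          lintegral_mono' hμ le_rfl
      _ = ENNReal.ofReal (r ^ (1 / 4 : ℝ)) *
          (ENNReal.ofReal r⁻¹ * ∫⁻ x, transitionProfile ν x) := by
        rw [lintegral_const_mul _ hm,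
          lintegral_comp_mul_left_real (measurable_transitionProfile ν) hr]
      _ ≤ ENNReal.ofReal (r ^ (1 / 4 : ℝ)) *
          (ENNReal.ofReal r⁻¹ * ENNReal.ofReal (2 * ν ^ (1 / 2 : ℝ))) := by
        gcongr
        exact lintegral_transitionProfile_le hν
      _ = _ := by
        rw [← ENNReal.ofReal_mul (by positivity), ← ENNReal.ofReal_mul (by positivity)]
        congr 1
        rw [show (-(3 / 4) : ℝ) = 1 / 4 + -1 by norm_num, Real.rpow_add hr, Real.rpow_neg_one]
        ring
  refine (lintegral_mul_sq_le (hm.const_mul _).aemeasurable hf).trans ?_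
  refine (mul_le_mul_left hb _).trans ?_
  rw [← lintegral_const_mul' _ _ ENNReal.ofReal_ne_top]
  refine (lintegral_congr fun s => ?_).le
  rw [← mul_assoc, ← mul_assoc, ← ENNReal.ofReal_mul (by positivity)]
  congr 3
  rw [show (-(1 / 2) : ℝ) = -(3 / 4) + 1 / 4 by norm_num, Real.rpow_add hr]
  ring

/-- On the support `ν < rs` gives `ν^(1/2) r^(-1/2) ≤ s^(1/2)`, and `r ≤ 1` forces `s ≥ ν`. Scaling
by `s` bounds the mass in `r` by `2 s^(-1/2)`, so all powers cancel. -/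
theorem lintegral_transitionWeight_le {ν : ℝ} (hν : 1 ≤ ν) (s : ℝ) :
    ∫⁻ r in Ioc 0 1, ENNReal.ofReal (2 * ν ^ (1 / 2 : ℝ) * r ^ (-(1 / 2) : ℝ)) *
        transitionProfile ν (r * s) ≤ 4 := by
  have hν0 : 0 < ν := by linarith
  rcases lt_or_ge s ν with hs | hs
  · rw [setLIntegral_congr_fun (g := fun _ => 0) measurableSet_Ioc]
    · simp
    · intro r hr
      have : r * s ∉ Ioc ν (ν + ν ^ (2 / 3 : ℝ)) := fun h => by
        nlinarith [h.1, hr.1, hr.2]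
      simp only [transitionProfile, indicator_of_notMem this, mul_zero]
  · have hs0 : 0 < s := hν0.trans_le hs
    have hpt : ∀ r ∈ Ioc (0 : ℝ) 1,
        ENNReal.ofReal (2 * ν ^ (1 / 2 : ℝ) * r ^ (-(1 / 2) : ℝ)) * transitionProfile ν (r * s) ≤
        ENNReal.ofReal (2 * s ^ (1 / 2 : ℝ)) * transitionProfile ν (s * r) := by
      intro r hr
      rw [mul_comm s r]
      by_cases hmem : r * s ∈ Ioc ν (ν + ν ^ (2 / 3 : ℝ))
      · have hr0 := hr.1
        refine mul_le_mul_left (ENNReal.ofReal_le_ofReal ?_) _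
        rw [mul_assoc]
        refine mul_le_mul_of_nonneg_left ?_ zero_le_two
        rw [Real.rpow_neg hr0.le, ← div_eq_mul_inv, div_le_iff₀ (by positivity),
          ← Real.mul_rpow hs0.le hr0.le, mul_comm s r]
        exact Real.rpow_le_rpow hν0.le hmem.1.le (by norm_num)
      · simp only [transitionProfile, indicator_of_notMem hmem, mul_zero, le_refl]
    calc _ ≤ ∫⁻ r in Ioc 0 1,
          ENNReal.ofReal (2 * s ^ (1 / 2 : ℝ)) * transitionProfile ν (s * r) :=
          setLIntegral_mono' measurableSet_Ioc hpt
      _ ≤ ∫⁻ r, ENNReal.ofReal (2 * s ^ (1 / 2 : ℝ)) * transitionProfile ν (s * r) :=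
          setLIntegral_le_lintegral _ _
      _ = ENNReal.ofReal (2 * s ^ (1 / 2 : ℝ)) *
          (ENNReal.ofReal s⁻¹ * ∫⁻ x, transitionProfile ν x) := by
        rw [lintegral_const_mul' _ _ ENNReal.ofReal_ne_top,
          lintegral_comp_mul_left_real (measurable_transitionProfile ν) hs0]
      _ ≤ ENNReal.ofReal (2 * s ^ (1 / 2 : ℝ)) *
          (ENNReal.ofReal s⁻¹ * ENNReal.ofReal (2 * s ^ (1 / 2 : ℝ))) := by
        gcongr
        refine (lintegral_transitionProfile_le hν).trans (ENNReal.ofReal_le_ofReal ?_)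
        gcongr
      _ = 4 := by
        rw [← ENNReal.ofReal_mul (by positivity), ← ENNReal.ofReal_mul (by positivity)]
        have h : s ^ (1 / 2 : ℝ) * s ^ (1 / 2 : ℝ) = s := by
          rw [← Real.rpow_add hs0]; norm_num
        rw [show 2 * s ^ (1 / 2 : ℝ) * (s⁻¹ * (2 * s ^ (1 / 2 : ℝ)))
          = 4 * (s⁻¹ * (s ^ (1 / 2 : ℝ) * s ^ (1 / 2 : ℝ))) by ring, h, inv_mul_cancel₀ hs0.ne']
        norm_num

theorem lintegral_enorm_transitionOp_sq_le {ν C : ℝ} (hν : 1 ≤ ν) (hC : 0 ≤ C)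
    (hJ : ∀ x : ℝ, ν < x → x ≤ 2 * ν →
      |besselJTilde ν x| ≤ C * ν ^ (1 / 4 : ℝ) * (x - ν) ^ (-(1 / 4) : ℝ))
    (I : Set ℝ) (t : ℝ → ℝ) {g : ℝ → ℂ} (hg : AEStronglyMeasurable g (volume.restrict I)) :
    ∫⁻ r in Icc 0 1, ‖transitionOp ν I t g r‖ₑ ^ 2 ≤
      ENNReal.ofReal (2 * C) ^ 2 * ∫⁻ s in I, ‖g s‖ₑ ^ 2 := by
  have hpt : ∀ r ∈ Ioc (0 : ℝ) 1, ‖transitionOp ν I t g r‖ₑ ^ 2 ≤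
      ENNReal.ofReal C ^ 2 * ∫⁻ s in I,
        ENNReal.ofReal (2 * ν ^ (1 / 2 : ℝ) * r ^ (-(1 / 2) : ℝ)) *
          transitionProfile ν (r * s) * ‖g s‖ₑ ^ 2 := by
    intro r hr
    have hne : ∀ᵐ s ∂(volume.restrict I), r * s ≠ ν := by
      refine ae_restrict_of_ae ?_
      filter_upwards [Measure.ae_ne volume (ν / r)] with s hs h
      exact hs (by rw [← h, mul_div_cancel_left₀ _ hr.1.ne'])
    -- The kernel bound may fail only at `s = ν/r`, a null set.
    have h1 : ‖transitionOp ν I t g r‖ₑ ≤ ENNReal.ofReal C *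
        ∫⁻ s in I, ENNReal.ofReal (r ^ (1 / 4 : ℝ)) * transitionProfile ν (r * s) * ‖g s‖ₑ := by
      refine (enorm_integral_le_lintegral_enorm _).trans ?_
      rw [← lintegral_const_mul' _ _ ENNReal.ofReal_ne_top]
      refine lintegral_mono_ae ?_
      filter_upwards [hne] with s hs
      rw [enorm_mul, ← mul_assoc]
      gcongr
      exact enorm_transitionKernel_le hν hC hJ t hr.1 hs
    refine (pow_le_pow_left' h1 2).trans ?_
    rw [mul_pow]
    gcongr
    exact sq_lintegral_transitionProfile_mul_le hν Measure.restrict_le_self hg.enorm hr.1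
  have hmeas : AEMeasurable (Function.uncurry fun r s : ℝ =>
      ENNReal.ofReal (2 * ν ^ (1 / 2 : ℝ) * r ^ (-(1 / 2) : ℝ)) *
          transitionProfile ν (r * s) * ‖g s‖ₑ ^ 2)
      ((volume.restrict (Ioc 0 1)).prod (volume.restrict I)) :=
    (measurable_transitionWeight ν).aemeasurable.mul (hg.enorm.comp_snd.pow_const 2)
  rw [← Measure.restrict_congr_set (Ioc_ae_eq_Icc (a := (0 : ℝ)) (b := 1))]
  refine (setLIntegral_mono' measurableSet_Ioc hpt).trans ?_
  rw [lintegral_const_mul' _ _ (by finiteness), lintegral_lintegral_swap hmeas]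
  have hw : ∀ s : ℝ, ∫⁻ r in Ioc 0 1, ENNReal.ofReal (2 * ν ^ (1 / 2 : ℝ) * r ^ (-(1 / 2) : ℝ)) *
      transitionProfile ν (r * s) * ‖g s‖ₑ ^ 2 ≤ 4 * ‖g s‖ₑ ^ 2 := by
    intro s
    rw [lintegral_mul_const' _ _ (by finiteness)]
    gcongr
    exact lintegral_transitionWeight_le hν s
  calc _ ≤ ENNReal.ofReal C ^ 2 * ∫⁻ s in I, 4 * ‖g s‖ₑ ^ 2 := by
        gcongr with s
        exact hw s
    _ = _ := by
      rw [lintegral_const_mul' _ _ (by finiteness), ENNReal.ofReal_mul zero_le_two, mul_pow,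
        ENNReal.ofReal_ofNat]
      ring

theorem eLpNorm_transitionOp_le {ν C : ℝ} (hν : 1 ≤ ν) (hC : 0 ≤ C)
    (hJ : ∀ x : ℝ, ν < x → x ≤ 2 * ν →
      |besselJTilde ν x| ≤ C * ν ^ (1 / 4 : ℝ) * (x - ν) ^ (-(1 / 4) : ℝ))
    (I : Set ℝ) (t : ℝ → ℝ) {g : ℝ → ℂ} (hg : AEStronglyMeasurable g (volume.restrict I)) :
    eLpNorm (transitionOp ν I t g) 2 (volume.restrict (Icc 0 1)) ≤
      ENNReal.ofReal (2 * C) * eLpNorm g 2 (volume.restrict I) := by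
  rw [eLpNorm_eq_lintegral_rpow_enorm_toReal two_ne_zero ENNReal.ofNat_ne_top,
    eLpNorm_eq_lintegral_rpow_enorm_toReal two_ne_zero ENNReal.ofNat_ne_top]
  simp only [ENNReal.toReal_ofNat, ENNReal.rpow_two]
  refine (ENNReal.rpow_le_rpow (lintegral_enorm_transitionOp_sq_le hν hC hJ I t hg)
    (by norm_num)).trans_eq ?_
  rw [ENNReal.mul_rpow_of_nonneg _ _ (by norm_num), ← ENNReal.rpow_two, ← ENNReal.rpow_mul]
  norm_num

/-! ### Measurability and absolute convergence -/

theorem aemeasurable_transitionKernel {ν : ℝ} (hν : 1 ≤ ν) {α : Type*} [MeasurableSpace α]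
    {μ : Measure α} {t : ℝ → ℝ} {r s : α → ℝ} (hr : AEMeasurable r μ) (hs : AEMeasurable s μ)
    (ht : AEMeasurable (fun a => t (r a)) μ) :
    AEMeasurable (fun a => transitionKernel ν t (r a) (s a)) μ := by
  have hJ : Measurable (besselJTilde ν) := (continuous_besselJTilde hν).measurable
  have hind : Measurable ((Icc ν (ν + ν ^ (2 / 3 : ℝ))).indicator fun _ => (1 : ℝ)) :=
    measurable_const.indicator measurableSet_Icc
  have hrs : AEMeasurable (fun a => r a * s a) μ := hr.mul hs
  have h1 : AEMeasurable (fun a => t (r a) * s a ^ 2) μ := ht.mul (hs.pow_const 2)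
  have h2 : AEMeasurable (fun a => besselJTilde ν (r a * s a) *
      (Icc ν (ν + ν ^ (2 / 3 : ℝ))).indicator (fun _ => (1 : ℝ)) (r a * s a) *
      s a ^ (-(1 / 4) : ℝ)) μ :=
    ((hJ.comp_aemeasurable hrs).mul (hind.comp_aemeasurable hrs)).mul (hs.pow_const _)
  have h3 : AEMeasurable (fun a => Complex.I * ((t (r a) * s a ^ 2 : ℝ) : ℂ)) μ :=
    (Complex.measurable_ofReal.comp_aemeasurable h1).const_mul _
  simp only [transitionKernel]
  exact (Complex.measurable_exp.comp_aemeasurable h3).mul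
    (Complex.measurable_ofReal.comp_aemeasurable h2)

theorem aestronglyMeasurable_transitionOp {ν : ℝ} (hν : 1 ≤ ν) (I : Set ℝ) {t : ℝ → ℝ}
    {g : ℝ → ℂ} (hg : AEStronglyMeasurable g (volume.restrict I)) {μ : Measure ℝ} [SFinite μ]
    (ht : AEMeasurable t μ) :
    AEStronglyMeasurable (transitionOp ν I t g) μ := by
  have ht' : AEMeasurable (fun q : ℝ × ℝ => t q.1) (μ.prod (volume.restrict I)) := ht.comp_fst
  have hK : AEMeasurable (fun q : ℝ × ℝ => transitionKernel ν t q.1 q.2)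
      (μ.prod (volume.restrict I)) :=
    aemeasurable_transitionKernel hν measurable_fst.aemeasurable measurable_snd.aemeasurable ht'
  have hg' : AEStronglyMeasurable (fun q : ℝ × ℝ => g q.2) (μ.prod (volume.restrict I)) :=
    hg.comp_snd
  have hF : AEStronglyMeasurable (fun q : ℝ × ℝ => transitionKernel ν t q.1 q.2 * g q.2)
      (μ.prod (volume.restrict I)) := hK.aestronglyMeasurable.mul hg'
  exact hF.integral_prod_right'

/-- For `r > 0` the kernel is bounded and supported in a compact interval away from `s = 0`, where
an `L²` function is integrable; for `r = 0` it vanishes. With `r` fixed, `t r` is a constant, so no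
regularity of `t` enters. -/
theorem integrableOn_transitionKernel_mul {ν : ℝ} (hν : 1 ≤ ν) {I : Set ℝ} (t : ℝ → ℝ)
    {g : ℝ → ℂ} (hg : MemLp g 2 (volume.restrict I)) {r : ℝ} (hr : 0 ≤ r) :
    IntegrableOn (fun s => transitionKernel ν t r s * g s) I := by
  have hν0 : 0 < ν := by linarith
  rcases hr.eq_or_lt with rfl | hr
  · have : (fun s => transitionKernel ν t 0 s * g s) = fun _ => 0 := by
      funext s
      have : (0 : ℝ) * s ∉ Icc ν (ν + ν ^ (2 / 3 : ℝ)) := fun h => by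
        rw [zero_mul] at h; linarith [h.1]
      simp only [transitionKernel, indicator_of_notMem this]
      simp
    rw [this]
    exact integrableOn_zero
  set S := Icc (ν / r) ((ν + ν ^ (2 / 3 : ℝ)) / r) with hS
  have hzero : ∀ s, s ∉ S → transitionKernel ν t r s = 0 := by
    intro s hs
    have : r * s ∉ Icc ν (ν + ν ^ (2 / 3 : ℝ)) := fun h =>
      hs ⟨(div_le_iff₀' hr).2 h.1, (le_div_iff₀' hr).2 h.2⟩
    simp only [transitionKernel, indicator_of_notMem this]
    simp
  obtain ⟨M, hM⟩ := IsCompact.exists_bound_of_continuousOn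
    (isCompact_Icc (a := ν / r) (b := (ν + ν ^ (2 / 3 : ℝ)) / r))
    (f := fun s => besselJTilde ν (r * s) * s ^ (-(1 / 4) : ℝ))
    (((continuous_besselJTilde hν).comp (continuous_const.mul continuous_id)).continuousOn.mul
      (continuousOn_id.rpow_const fun s hs =>
        Or.inl (lt_of_lt_of_le (by positivity) hs.1).ne'))
  have hbound : ∀ s ∈ S, ‖transitionKernel ν t r s‖ ≤ M := by
    intro s hs
    have : r * s ∈ Icc ν (ν + ν ^ (2 / 3 : ℝ)) :=
      ⟨(div_le_iff₀' hr).1 hs.1, (le_div_iff₀' hr).1 hs.2⟩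
    rw [transitionKernel, indicator_of_mem this, norm_mul, mul_comm Complex.I,
      Complex.norm_exp_ofReal_mul_I, one_mul, mul_one, Complex.norm_real]
    exact hM s hs
  have hK : AEMeasurable (fun s => transitionKernel ν t r s) ((volume.restrict I).restrict S) :=
    aemeasurable_transitionKernel hν (r := fun _ => r) aemeasurable_const aemeasurable_id
      aemeasurable_const
  have hfin : IsFiniteMeasure ((volume.restrict I).restrict S) :=
    ⟨by
      rw [Measure.restrict_apply_univ]
      exact (Measure.restrict_apply_le _ _).trans_lt measure_Icc_lt_top⟩
  have hgS : Integrable g ((volume.restrict I).restrict S) :=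
    (hg.restrict S).integrable one_le_two
  have hint : IntegrableOn (fun s => transitionKernel ν t r s * g s) S (volume.restrict I) :=
    hgS.bdd_mul hK.aestronglyMeasurable
      ((ae_restrict_mem measurableSet_Icc).mono hbound)
  refine (integrableOn_iff_integrable_of_support_subset fun s hs => ?_).1 hint
  by_contra h
  exact hs (by simp only [hzero s h, zero_mul])
theorem proposition3p1 :
    ∃ C : ℝ, 0 < C ∧
      ∀ ν : ℝ, 1 ≤ ν →
      ∀ I : Set ℝ, I.OrdConnected → I ⊆ Ici 0 →
      ∀ t : ℝ → ℝ,
      ∀ g : ℝ → ℂ, MemLp g 2 (volume.restrict I) →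
        (∀ r ∈ Icc (0 : ℝ) 1, IntegrableOn (fun s => transitionKernel ν t r s * g s) I) ∧
        (AEMeasurable t (volume.restrict (Icc 0 1)) →
          MemLp (transitionOp ν I t g) 2 (volume.restrict (Icc 0 1))) ∧
        eLpNorm (transitionOp ν I t g) 2 (volume.restrict (Icc 0 1)) ≤
          ENNReal.ofReal C * eLpNorm g 2 (volume.restrict I) := by
  obtain ⟨C, hC, hJ⟩ := exists_abs_besselJTilde_le
  refine ⟨2 * C, by positivity, fun ν hν I _ _ t g hg => ?_⟩
  have hnorm := eLpNorm_transitionOp_le hν hC.le (hJ ν hν) I t hg.aestronglyMeasurable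
  exact ⟨fun r hr => integrableOn_transitionKernel_mul hν t hg hr.1,
    fun ht => ⟨aestronglyMeasurable_transitionOp hν I hg.aestronglyMeasurable ht,
      hnorm.trans_lt (ENNReal.mul_lt_top ENNReal.ofReal_lt_top hg.eLpNorm_lt_top)⟩, hnorm⟩
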